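/- Let $G=(V,E)$ be a simple hypergraph: $V=\{x_1,\dots,x_n\}$ is a finite set of vertices, $E=\{e_1,\dots,e_m\}$ is a set of nonempty subsets of $V$ (the edges), and no edge contains another; $E=\varnothing$ and one-element edges are allowed. Let $K$ be a field, $S=K[x_1,\dots,x_n]$, and let $I=I(G)=\bigl(\prod_{x\in e}x : e\in E\bigr)\subseteq S$ be the edge ideal of $G$. Then the following conditions are equivalent: 1. $G$ has the max-flow-min-cut property: with $A$ the $n\times m$ incidence matrix of $G$ ($A_{ij}=1$ if $x_i\in e_j$, and $0$ otherwise), for every vector $\mathbf c\in\mathbb Z_{\ge 0}^n$ both of the dual linear programs $$\max\{\langle \mathbf 1,\mathbf y\rangle : \mathbf y\in\mathbb R^m_{\ge 0},\ A\mathbf y\le \mathbf c\}\quad\text{and}\quad \min\{\langle \mathbf c,\mathbf z\rangle : \mathbf z\in\mathbb R^n_{\ge 0},\ A^{T}\mathbf z\ge \mathbf 1\}$$ have integral optimal solutions $\mathbf y$ and $\mathbf z$; 2. $I^{(q)}=I^q$ for all $q\ge 0$, where $I^{(q)}=\bigcap_{\mathfrak p\in\operatorname{Ass}(S/I)}\mathfrak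 p^q$ is the $q$-th symbolic power; 3. the associated graded ring $\operatorname{gr}_I=\bigoplus_{q\ge 0}I^q/I^{q+1}$ is reduced; 4. $I$ is normally torsion-free, i.e. all the powers $I^q$, $q\ge 1$, have the same associated primes $\operatorname{Ass}(S/I^q)$. -/

import Mathlib

open scoped Matrix DirectSum

noncomputable section

/-! ### The associated graded ring of an ideal -/

namespace AssocGraded

variable {R : Type*} [CommRing R] (I : Ideal R)

/-- The submodule `I ^ (q + 1)` of the `R`-module `I ^ q`. -/
def sub (q : ℕ) : Submodule R ↥(I ^ q) :=
  Submodule.comap (Submodule.subtype (I ^ q)) (I ^ (q + 1))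

/-- The graded piece `I ^ q / I ^ (q + 1)`. -/
def Piece (q : ℕ) : Type _ := ↥(I ^ q) ⧸ sub I q

instance (q : ℕ) : AddCommGroup (Piece I q) :=
  inferInstanceAs (AddCommGroup (↥(I ^ q) ⧸ sub I q))

instance (q : ℕ) : Module R (Piece I q) :=
  inferInstanceAs (Module R (↥(I ^ q) ⧸ sub I q))

/-- The quotient map `I ^ q → I ^ q / I ^ (q + 1)`. -/
def mk (q : ℕ) : ↥(I ^ q) →ₗ[R] Piece I q := Submodule.mkQ (sub I q)

theorem mk_surjective (q : ℕ) : Function.Surjective (mk I q) :=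
  Submodule.mkQ_surjective (sub I q)

theorem mk_eq_zero_iff {q : ℕ} (a : ↥(I ^ q)) : mk I q a = 0 ↔ (a : R) ∈ I ^ (q + 1) := by
  change Submodule.Quotient.mk a = (0 : ↥(I ^ q) ⧸ sub I q) ↔ _
  rw [Submodule.Quotient.mk_eq_zero]
  rfl

/-- The multiplication `I ^ i × I ^ j → I ^ (i + j)`. -/
def powMul (i j : ℕ) : ↥(I ^ i) →ₗ[R] ↥(I ^ j) →ₗ[R] ↥(I ^ (i + j)) :=
  LinearMap.mk₂ R
    (fun a b => ⟨(a : R) * b, by rw [pow_add]; exact Ideal.mul_mem_mul a.2 b.2⟩)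
    (fun a b c => Subtype.ext (add_mul (a : R) b c))
    (fun r a b => Subtype.ext (mul_assoc r (a : R) b))
    (fun a b c => Subtype.ext (mul_add (a : R) b c))
    (fun r a b => Subtype.ext (mul_left_comm (a : R) r b))

/-- The multiplication on graded pieces: the class of `a` times the class of `b` is the class of
`a * b`. -/
def mulPiece (i j : ℕ) : Piece I i →ₗ[R] Piece I j →ₗ[R] Piece I (i + j) :=
  Submodule.liftQ (sub I i)
    (LinearMap.flip (Submodule.liftQ (sub I j)
      (LinearMap.flip ((powMul I i j).compr₂ (mk I (i + j))))
      (by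
        intro b hb
        rw [LinearMap.mem_ker]
        ext a
        change mk I (i + j) (powMul I i j a b) = 0
        rw [mk_eq_zero_iff]
        have h : (a : R) * b ∈ I ^ i * I ^ (j + 1) := Ideal.mul_mem_mul a.2 hb
        rwa [← pow_add, ← add_assoc] at h)))
    (by
      intro a ha
      rw [LinearMap.mem_ker]
      ext b
      obtain ⟨b, rfl⟩ := mk_surjective I j b
      change mk I (i + j) (powMul I i j a b) = 0
      rw [mk_eq_zero_iff]
      have h : (a : R) * b ∈ I ^ (i + 1) * I ^ j := Ideal.mul_mem_mul ha b.2
      rwa [← pow_add, add_right_comm] at h)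

theorem mulPiece_mk_mk {i j : ℕ} (a : ↥(I ^ i)) (b : ↥(I ^ j)) :
    mulPiece I i j (mk I i a) (mk I j b) = mk I (i + j) (powMul I i j a b) := rfl

theorem gradedMk_eq {i j : ℕ} (h : i = j) (a : ↥(I ^ i)) (b : ↥(I ^ j)) (hab : (a : R) = b) :
    GradedMonoid.mk (A := Piece I) i (mk I i a) = GradedMonoid.mk j (mk I j b) := by
  subst h
  rw [Subtype.ext hab]

instance : GradedMonoid.GOne (Piece I) where
  one := mk I 0 ⟨1, by simp⟩

instance : GradedMonoid.GMul (Piece I) where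
  mul {i j} a b := mulPiece I i j a b

instance : DirectSum.GCommRing (Piece I) where
  mul_zero a := map_zero _
  zero_mul b := by
    change mulPiece I _ _ 0 b = 0
    rw [map_zero, LinearMap.zero_apply]
  mul_add a b c := map_add _ _ _
  add_mul a b c := by
    change mulPiece I _ _ (a + b) c = mulPiece I _ _ a c + mulPiece I _ _ b c
    rw [map_add, LinearMap.add_apply]
  one_mul := by
    rintro ⟨i, a⟩
    obtain ⟨a, rfl⟩ := mk_surjective I i a
    exact gradedMk_eq I (zero_add i) _ _ (one_mul (a : R))
  mul_one := by
    rintro ⟨i, a⟩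
    obtain ⟨a, rfl⟩ := mk_surjective I i a
    exact gradedMk_eq I (add_zero i) _ _ (mul_one (a : R))
  mul_assoc := by
    rintro ⟨i, a⟩ ⟨j, b⟩ ⟨k, c⟩
    obtain ⟨a, rfl⟩ := mk_surjective I i a
    obtain ⟨b, rfl⟩ := mk_surjective I j b
    obtain ⟨c, rfl⟩ := mk_surjective I k c
    exact gradedMk_eq I (add_assoc i j k) _ _ (mul_assoc (a : R) b c)
  mul_comm := by
    rintro ⟨i, a⟩ ⟨j, b⟩
    obtain ⟨a, rfl⟩ := mk_surjective I i a
    obtain ⟨b, rfl⟩ := mk_surjective I j b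
    exact gradedMk_eq I (add_comm i j) _ _ (mul_comm (a : R) b)
  natCast n := n • GradedMonoid.GOne.one
  natCast_zero := zero_smul ℕ _
  natCast_succ n := succ_nsmul _ n
  intCast n := n • GradedMonoid.GOne.one
  intCast_ofNat n := natCast_zsmul _ n
  intCast_negSucc_ofNat n := negSucc_zsmul _ n

end AssocGraded

/-- The associated graded ring `gr_I = ⨁ q, I ^ q / I ^ (q + 1)`, with the commutative ring
structure in which `[a] * [b] = [a * b]` for `a ∈ I ^ i`, `b ∈ I ^ j`. -/
abbrev AssocGradedRing {R : Type*} [CommRing R] (I : Ideal R) : Type _ :=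
  ⨁ q, AssocGraded.Piece I q

theorem AssocGraded.of_mk_mul_of_mk {R : Type*} [CommRing R] (I : Ideal R) {i j : ℕ}
    (a : ↥(I ^ i)) (b : ↥(I ^ j)) :
    (DirectSum.of (AssocGraded.Piece I) i (AssocGraded.mk I i a) *
        DirectSum.of (AssocGraded.Piece I) j (AssocGraded.mk I j b) : AssocGradedRing I) =
      DirectSum.of (AssocGraded.Piece I) (i + j)
        (AssocGraded.mk I (i + j) (AssocGraded.powMul I i j a b)) :=
  DirectSum.of_mul_of _ _

/-! ### Symbolic powers and normal torsion-freeness -/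

/-- The symbolic power `I^(s) = ⋂ p ∈ Ass(R/I), p ^ s` of an ideal that is an intersection of
primes, such as a squarefree monomial ideal. -/
def symbPow {R : Type*} [CommRing R] (I : Ideal R) (s : ℕ) : Ideal R :=
  ⨅ p ∈ associatedPrimes R (R ⧸ I), p ^ s

/-- `I` is normally torsion-free: all the powers `I ^ q`, `q ≥ 1`, have the same associated
primes. -/
def IsNormallyTorsionFree {R : Type*} [CommRing R] (I : Ideal R) : Prop :=
  ∀ p q : ℕ, 1 ≤ p → 1 ≤ q →
    associatedPrimes R (R ⧸ I ^ p) = associatedPrimes R (R ⧸ I ^ q)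

/-! ### Hypergraphs, edge ideals and the max-flow-min-cut property -/

namespace Hypergraph

variable {α : Type*} (G : Hypergraph α)

/-- A hypergraph is simple if no edge contains another. -/
def IsSimple : Prop := ∀ e ∈ G.edgeSet, ∀ f ∈ G.edgeSet, e ⊆ f → e = f

open Classical in
/-- The squarefree monomial `∏ x ∈ e, x` in `K[V]`. -/
def edgeMonomial [Fintype G.vertexSet] (K : Type*) [Field K] (e : Set α) :
    MvPolynomial G.vertexSet K :=
  ∏ v : G.vertexSet, if (v : α) ∈ e then MvPolynomial.X v else 1

/-- The edge ideal `I(G) ⊆ K[V]`, generated by the monomials of the edges. -/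
def edgeIdeal [Fintype G.vertexSet] (K : Type*) [Field K] : Ideal (MvPolynomial G.vertexSet K) :=
  Ideal.span (G.edgeMonomial K '' G.edgeSet)

open Classical in
/-- The incidence matrix: rows are vertices, columns are edges. -/
def incMatrix : Matrix G.vertexSet G.edgeSet ℝ :=
  fun v e => if (v : α) ∈ (e : Set α) then 1 else 0

/-- The feasible region `{y ∈ ℝ_{≥0}^E | A y ≤ c}`. -/
def packings [Fintype G.edgeSet] (c : G.vertexSet → ℝ) : Set (G.edgeSet → ℝ) :=
  {y | 0 ≤ y ∧ G.incMatrix *ᵥ y ≤ c}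

/-- The feasible region `{z ∈ ℝ_{≥0}^V | Aᵀ z ≥ 1}`. -/
def coverings [Fintype G.vertexSet] : Set (G.vertexSet → ℝ) :=
  {z | 0 ≤ z ∧ 1 ≤ G.incMatrixᵀ *ᵥ z}

/-- The max-flow-min-cut property: for every `c ∈ ℤ_{≥0}^V`, both linear programs
`max {⟨1, y⟩ | y ∈ ℝ_{≥0}^E, A y ≤ c}` and `min {⟨c, z⟩ | z ∈ ℝ_{≥0}^V, Aᵀ z ≥ 1}`
have integral optimal solutions (optimal among all real feasible points). -/
def HasMFMC [Fintype G.vertexSet] [Fintype G.edgeSet] : Prop :=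
  ∀ c : G.vertexSet → ℕ,
    (∃ y : G.edgeSet → ℤ,
      (fun e => (y e : ℝ)) ∈ G.packings (fun v => (c v : ℝ)) ∧
      IsMaxOn (fun y' : G.edgeSet → ℝ => 1 ⬝ᵥ y') (G.packings (fun v => (c v : ℝ)))
        (fun e => (y e : ℝ))) ∧
    (∃ z : G.vertexSet → ℤ,
      (fun v => (z v : ℝ)) ∈ G.coverings ∧
      IsMinOn (fun z' : G.vertexSet → ℝ => (fun v => (c v : ℝ)) ⬝ᵥ z') G.coverings
        (fun v => (z v : ℝ)))

end Hypergraph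

end

/-! Let `ν(a)` be the packing number: the largest `q` such that `q` edges, repetition allowed, have
exponent sum at most `a`. A monomial with exponent `a` lies in `I^q` exactly when `q ≤ ν(a)`. The
number `ν` is always superadditive; the hub of the proof is homogeneity, `ν(ka) ≤ k ν(a)`.

Homogeneity follows from max-flow-min-cut, since a packing of `ka` divided by `k` is a fractional
packing of `a`. It also follows from reducedness: if `ν(ka) > k ν(a)`, the class of the monomial in
degree `ν(a)` is nilpotent but nonzero.

Conversely, homogeneity yields a cover `C` with `a(C) ≤ ν(a)` (`exists_isCover_sum_le`), without
strong LP duality. This cover and an optimal integral packing certify each other. It also gives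
equality of symbolic and ordinary powers, because the associated primes of `I` are the ideals `P_C`
generated by minimal covers, and `P_C^q` is described by `a(C) ≥ q`.

The order along `P_C` is additive on products. This gives reducedness from equality of powers, and
makes `P_C^q` primary, from which the link with normal torsion-freeness follows. -/

namespace Packing

/-! ### Integral packings and the packing number -/

variable {σ ε : Type*} [Fintype ε]

/-- Some nonnegative integral combination of the vectors `d e` with total weight at least `q`
is bounded by `a`. -/
def Packs (d : ε → σ →₀ ℕ) (q : ℕ) (a : σ →₀ ℕ) : Prop :=
  ∃ y : ε → ℕ, q ≤ ∑ e, y e ∧ ∑ e, y e • d e ≤ a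

/-- A set of vertices that meets the support of every `d e`. -/
def IsCover (d : ε → σ →₀ ℕ) (C : Finset σ) : Prop := ∀ e, ∃ v ∈ C, d e v ≠ 0

variable {d : ε → σ →₀ ℕ}

theorem Packs.mono {p q : ℕ} {a b : σ →₀ ℕ} (h : Packs d q a) (hpq : p ≤ q) (hab : a ≤ b) :
    Packs d p b := by
  obtain ⟨y, hy, hya⟩ := h
  exact ⟨y, hpq.trans hy, hya.trans hab⟩

theorem packs_zero (a : σ →₀ ℕ) : Packs d 0 a := ⟨0, by simp, by simp⟩

theorem Packs.add {p q : ℕ} {a b : σ →₀ ℕ} (ha : Packs d p a) (hb : Packs d q b) :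
    Packs d (p + q) (a + b) := by
  obtain ⟨y, hy, hya⟩ := ha
  obtain ⟨z, hz, hzb⟩ := hb
  refine ⟨y + z, ?_, ?_⟩
  · simpa [Finset.sum_add_distrib] using add_le_add hy hz
  · simpa [add_smul, Finset.sum_add_distrib] using add_le_add hya hzb

theorem packs_one (e : ε) : Packs d 1 (d e) := by
  classical
  refine ⟨Pi.single e 1, ?_, ?_⟩
  · simp
  · rw [Finset.sum_eq_single e] <;> simp +contextual

/-- Removing one copy of a vector that is used. -/
theorem exists_remove {y : ε → ℕ} {e : ε} (he : y e ≠ 0) :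
    ∃ z : ε → ℕ, ∑ f, y f = ∑ f, z f + 1 ∧ ∑ f, y f • d f = ∑ f, z f • d f + d e := by
  classical
  obtain ⟨z, rfl⟩ : ∃ z : ε → ℕ, y = z + Pi.single e 1 := by
    refine ⟨y - Pi.single e 1, ?_⟩
    rw [tsub_add_cancel_of_le]
    intro f
    by_cases h : f = e
    · subst h; simp; omega
    · simp [h]
  refine ⟨z, by simp [Finset.sum_add_distrib], ?_⟩
  simp only [Pi.add_apply, add_smul, Finset.sum_add_distrib, add_right_inj]
  rw [Finset.sum_eq_single e] <;> simp +contextual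

/-- The combinatorial shadow of `I^(q+1) = I^q * I`; it drives the inductions on `q`. -/
theorem packs_succ_iff {q : ℕ} {a : σ →₀ ℕ} :
    Packs d (q + 1) a ↔ ∃ b e, Packs d q b ∧ b + d e ≤ a := by
  constructor
  · rintro ⟨y, hy, hya⟩
    obtain ⟨e, -, he⟩ : ∃ e ∈ Finset.univ, y e ≠ 0 := by
      by_contra! h
      rw [Finset.sum_eq_zero h] at hy
      omega
    obtain ⟨z, hz, hz'⟩ := exists_remove (d := d) he
    exact ⟨∑ f, z f • d f, e, ⟨z, by omega, le_rfl⟩, hz' ▸ hya⟩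
  · rintro ⟨b, e, hb, hbe⟩
    exact (hb.add (packs_one e)).mono le_rfl hbe

theorem Packs.le_sum_cover {q : ℕ} {a : σ →₀ ℕ} (h : Packs d q a) {C : Finset σ}
    (hC : IsCover d C) : q ≤ ∑ v ∈ C, a v := by
  induction q generalizing a with
  | zero => exact Nat.zero_le _
  | succ q ih =>
    obtain ⟨b, e, hb, hbe⟩ := packs_succ_iff.1 h
    obtain ⟨v, hv, hev⟩ := hC e
    calc q + 1 ≤ ∑ v ∈ C, b v + ∑ v ∈ C, d e v :=
          add_le_add (ih hb) ((Nat.one_le_iff_ne_zero.2 hev).trans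
            (Finset.single_le_sum (f := fun v => d e v) (fun _ _ => Nat.zero_le _) hv))
      _ ≤ ∑ v ∈ C, a v := by
          rw [← Finset.sum_add_distrib]
          exact Finset.sum_le_sum fun v _ => hbe v

theorem Packs.le_degree (hd : ∀ e, d e ≠ 0) {q : ℕ} {a : σ →₀ ℕ} (h : Packs d q a) :
    q ≤ a.degree := by
  induction q generalizing a with
  | zero => exact Nat.zero_le _
  | succ q ih =>
    obtain ⟨b, e, hb, hbe⟩ := packs_succ_iff.1 h
    have h1 : (d e).degree ≠ 0 := fun h0 => hd e ((Finsupp.degree_eq_zero_iff _).1 h0)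
    obtain ⟨c, rfl⟩ := exists_add_of_le hbe
    have := ih hb
    simp only [map_add]
    omega

/-- The maximal size of an integral packing of the vectors `d e` below `a`. -/
noncomputable def packingNumber (d : ε → σ →₀ ℕ) (a : σ →₀ ℕ) : ℕ := sSup {q | Packs d q a}

/-- Nonzero vectors make the set of packing sizes bounded by the degree of `a`, so the supremum is
attained and not the default value 0 of an unbounded set. -/
theorem le_packingNumber_iff (hd : ∀ e, d e ≠ 0) {q : ℕ} {a : σ →₀ ℕ} :
    q ≤ packingNumber d a ↔ Packs d q a := by
  have hb : BddAbove {q | Packs d q a} := ⟨a.degree, fun q h => Packs.le_degree hd h⟩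
  refine ⟨fun h => ?_, fun h => le_csSup hb h⟩
  exact Packs.mono (Nat.sSup_mem ⟨0, packs_zero a⟩ hb) h le_rfl

theorem packs_packingNumber (hd : ∀ e, d e ≠ 0) (a : σ →₀ ℕ) :
    Packs d (packingNumber d a) a := (le_packingNumber_iff hd).1 le_rfl

theorem packingNumber_mono (hd : ∀ e, d e ≠ 0) {a b : σ →₀ ℕ} (h : a ≤ b) :
    packingNumber d a ≤ packingNumber d b :=
  (le_packingNumber_iff hd).2 ((packs_packingNumber hd a).mono le_rfl h)

theorem packingNumber_add_le (hd : ∀ e, d e ≠ 0) (a b : σ →₀ ℕ) :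
    packingNumber d a + packingNumber d b ≤ packingNumber d (a + b) :=
  (le_packingNumber_iff hd).2 ((packs_packingNumber hd a).add (packs_packingNumber hd b))

theorem mul_packingNumber_le (hd : ∀ e, d e ≠ 0) (k : ℕ) (a : σ →₀ ℕ) :
    k * packingNumber d a ≤ packingNumber d (k • a) := by
  induction k with
  | zero => simp
  | succ k ih =>
    rw [add_mul, one_mul, add_smul, one_smul]
    exact (Nat.add_le_add_right ih _).trans (packingNumber_add_le hd _ _)

theorem sum_packingNumber_le (hd : ∀ e, d e ≠ 0) {ι : Type*} (s : Finset ι)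
    (f : ι → σ →₀ ℕ) :
    ∑ i ∈ s, packingNumber d (f i) ≤ packingNumber d (∑ i ∈ s, f i) := by
  classical
  induction s using Finset.induction_on with
  | empty => simp
  | insert i s hi ih =>
    rw [Finset.sum_insert hi, Finset.sum_insert hi]
    exact (Nat.add_le_add_left ih _).trans (packingNumber_add_le hd _ _)

/-! ### From homogeneity to covers of equal weight -/

section Koenig

variable [Fintype σ]

/-- The vertices `v` such that adding `v` to a multiple of `b` increases the packing number. -/
noncomputable def critical (d : ε → σ →₀ ℕ) (b : σ →₀ ℕ) : Finset σ :=
  open Classical in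
  {v | ∃ N : ℕ, N * packingNumber d b + 1 ≤ packingNumber d (N • b + Finsupp.single v 1)}

theorem mem_critical {b : σ →₀ ℕ} {v : σ} : v ∈ critical d b ↔
    ∃ N : ℕ, N * packingNumber d b + 1 ≤ packingNumber d (N • b + Finsupp.single v 1) := by
  simp [critical]

theorem packingNumber_add_single_of_notMem (hd : ∀ e, d e ≠ 0) {b : σ →₀ ℕ} {w : σ}
    (hw : w ∉ critical d b) :
    packingNumber d (b + Finsupp.single w 1) = packingNumber d b := by
  refine le_antisymm ?_ (packingNumber_mono hd le_self_add)
  by_contra! h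
  exact hw (mem_critical.2 ⟨1, by simpa using h⟩)

/-- The packing number of `b` does not change, so the same multiple `N` still witnesses criticality.
-/
theorem critical_subset_of_notMem (hd : ∀ e, d e ≠ 0) {b : σ →₀ ℕ} {w : σ}
    (hw : w ∉ critical d b) :
    critical d b ⊆ critical d (b + Finsupp.single w 1) := by
  intro v hv
  obtain ⟨N, hN⟩ := mem_critical.1 hv
  refine mem_critical.2 ⟨N, ?_⟩
  rw [packingNumber_add_single_of_notMem hd hw]
  refine hN.trans (packingNumber_mono hd ?_)
  gcongr
  exact le_self_add

/-- Take `b v` copies of the witness `N v • b + single v 1` for each critical `v`. Their sum lies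
below `(M + 1) • b`, while superadditivity packs at least `M ν(b) + ∑ b v` into it. Homogeneity
bounds this by `(M + 1) ν(b)`. -/
theorem sum_critical_le (hd : ∀ e, d e ≠ 0)
    (H : ∀ k a, packingNumber d (k • a) ≤ k * packingNumber d a) (b : σ →₀ ℕ) :
    ∑ v ∈ critical d b, b v ≤ packingNumber d b := by
  have h1 : ∀ v : σ, ∃ N : ℕ, v ∈ critical d b →
      N * packingNumber d b + 1 ≤ packingNumber d (N • b + Finsupp.single v 1) := by
    intro v
    by_cases hv : v ∈ critical d b
    · exact (mem_critical.1 hv).imp fun N hN _ => hN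
    · exact ⟨0, fun h => (hv h).elim⟩
  choose N hN using h1
  set M := ∑ v ∈ critical d b, b v * N v
  have h2 : ∑ v ∈ critical d b, b v * (N v * packingNumber d b + 1) ≤
      packingNumber d (∑ v ∈ critical d b, b v • (N v • b + Finsupp.single v 1)) :=
    (Finset.sum_le_sum fun v hv => (Nat.mul_le_mul_left _ (hN v hv)).trans
      (mul_packingNumber_le hd _ _)).trans (sum_packingNumber_le hd _ _)
  have h3 : ∑ v ∈ critical d b, b v • (N v • b + Finsupp.single v 1) ≤ (M + 1) • b := by
    classical
    simp only [smul_add, Finset.sum_add_distrib, smul_smul, ← Finset.sum_smul, add_smul, one_smul]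
    refine add_le_add le_rfl fun w => ?_
    simp only [Finsupp.smul_single, smul_eq_mul, mul_one, Finsupp.coe_finsetSum,
      Finset.sum_apply, Finsupp.single_apply, Finset.sum_ite_eq']
    split_ifs <;> simp
  have h4 := h2.trans ((packingNumber_mono hd h3).trans (H _ _))
  have h5 : ∑ v ∈ critical d b, b v * (N v * packingNumber d b + 1) =
      M * packingNumber d b + ∑ v ∈ critical d b, b v := by
    simp only [mul_add, mul_one, Finset.sum_add_distrib, M, Finset.sum_mul, mul_assoc]
  rw [h5, add_mul, one_mul] at h4
  omega

/-- If the packing number is homogeneous, then packing numbers equal covering numbers. -/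
theorem exists_isCover_sum_le (hd : ∀ e, d e ≠ 0)
    (H : ∀ k a, packingNumber d (k • a) ≤ k * packingNumber d a) (a : σ →₀ ℕ) :
    ∃ C, IsCover d C ∧ ∑ v ∈ C, a v ≤ packingNumber d a := by
  -- Enlarge `a` to some `b` with the same packing number and as many critical vertices as possible.
  -- Raising a noncritical coordinate then changes neither the packing number nor the critical set,
  -- so this can be repeated at will.
  let T : Set ℕ := {n | ∃ b, a ≤ b ∧ packingNumber d b = packingNumber d a ∧
    (critical d b).card = n}
  have hT : BddAbove T := by
    refine ⟨Fintype.card σ, ?_⟩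
    rintro n ⟨b, -, -, rfl⟩
    exact Finset.card_le_univ _
  obtain ⟨b, hab, hb, hmax⟩ : sSup T ∈ T := Nat.sSup_mem ⟨_, a, le_rfl, rfl, rfl⟩ hT
  let Good : (σ →₀ ℕ) → Prop := fun x =>
    a ≤ x ∧ packingNumber d x = packingNumber d a ∧ critical d x = critical d b
  have step : ∀ x, Good x → ∀ w ∉ critical d b, Good (x + Finsupp.single w 1) := by
    rintro x ⟨h1, h2, h3⟩ w hw
    rw [← h3] at hw
    have h4 := packingNumber_add_single_of_notMem hd hw
    have h5 : a ≤ x + Finsupp.single w 1 := h1.trans le_self_add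
    refine ⟨h5, h4.trans h2, ?_⟩
    rw [← h3]
    refine (Finset.eq_of_subset_of_card_le (critical_subset_of_notMem hd hw) ?_).symm
    rw [h3, hmax]
    exact le_csSup hT ⟨_, h5, h4.trans h2, rfl⟩
  have steps : ∀ u : σ →₀ ℕ, (∀ v ∈ critical d b, u v = 0) → ∀ x, Good x → Good (x + u) := by
    intro u
    induction u using Finsupp.induction_linear with
    | zero => intro _ x hx; simpa using hx
    | add f g hf hg =>
      intro h x hx
      rw [← add_assoc]
      refine hg (fun v hv => ?_) _ (hf (fun v hv => ?_) x hx)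
      · have := h v hv; simp at this; exact this.2
      · have := h v hv; simp at this; exact this.1
    | single w n =>
      intro h
      induction n with
      | zero => intro x hx; simpa using hx
      | succ n ih =>
        intro x hx
        have hw : w ∉ critical d b := fun hw => by simpa using h w hw
        rw [Finsupp.single_add, ← add_assoc]
        refine step _ (ih (fun v hv => ?_) x hx) w hw
        exact Finsupp.single_eq_of_ne (fun h => hw (h ▸ hv))
  refine ⟨critical d b, fun e => ?_, ?_⟩
  -- An edge that misses the critical set could be added to `b` for free, yet it raises the packing
  -- number by one.
  · by_contra! h
    have h1 := (steps (d e) h b ⟨hab, hb, rfl⟩).2.1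
    have h2 := packingNumber_add_le hd b (d e)
    have h3 : 1 ≤ packingNumber d (d e) := (le_packingNumber_iff hd).2 (packs_one e)
    omega
  · rw [← hb]
    exact (Finset.sum_le_sum fun v _ => hab v).trans (sum_critical_le hd H b)

end Koenig

omit [Fintype ε] in
theorem IsCover.exists_minimal_subset {C : Finset σ} (hC : IsCover d C) :
    ∃ D ⊆ C, Minimal (IsCover d) D := by
  obtain ⟨D, hD, hmin⟩ := exists_minimal_le_of_wellFoundedLT (IsCover d) C hC
  exact ⟨D, hD, hmin⟩

end Packing

/-! ### Powers of monomial ideals and of primes generated by variables -/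

namespace Packing

open MvPolynomial

variable {σ ε K : Type*} [Fintype ε] [Field K]

/-- The monomial ideal generated by the monomials with exponents `d e`. -/
noncomputable def monomialIdeal (K : Type*) [Field K] (d : ε → σ →₀ ℕ) :
    Ideal (MvPolynomial σ K) :=
  Ideal.span (Set.range fun e => monomial (d e) 1)

variable {d : ε → σ →₀ ℕ}

theorem monomialIdeal_pow (q : ℕ) :
    monomialIdeal K d ^ q = Ideal.span ((fun a => monomial a 1) '' {a | Packs d q a}) := by
  induction q with
  | zero =>
    rw [pow_zero, Ideal.one_eq_top, eq_comm, Ideal.eq_top_iff_one]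
    exact Ideal.subset_span ⟨0, packs_zero 0, rfl⟩
  | succ q ih =>
    rw [pow_succ, ih, monomialIdeal, Ideal.span_mul_span']
    apply le_antisymm
    · rw [Ideal.span_le]
      rintro _ ⟨_, ⟨a, ha, rfl⟩, _, ⟨e, rfl⟩, rfl⟩
      refine Ideal.subset_span ⟨a + d e, packs_succ_iff.2 ⟨a, e, ha, le_rfl⟩, ?_⟩
      simp [monomial_mul]
    · rw [Ideal.span_le]
      rintro _ ⟨a, ha, rfl⟩
      obtain ⟨b, e, hb, hbe⟩ := packs_succ_iff.1 ha
      obtain ⟨c, rfl⟩ := exists_add_of_le hbe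
      have : (monomial (b + d e + c) 1 : MvPolynomial σ K) =
          monomial c 1 * (monomial b 1 * monomial (d e) 1) := by
        simp [monomial_mul, add_comm, add_left_comm]
      simp only [SetLike.mem_coe, this]
      exact Ideal.mul_mem_left _ _ (Ideal.subset_span
        (Set.mul_mem_mul ⟨b, hb, rfl⟩ ⟨e, rfl⟩))

theorem mem_monomialIdeal_pow {q : ℕ} {f : MvPolynomial σ K} :
    f ∈ monomialIdeal K d ^ q ↔ ∀ a ∈ f.support, Packs d q a := by
  rw [monomialIdeal_pow, mem_ideal_span_monomial_image]
  refine forall₂_congr fun a _ => ⟨?_, fun h => ⟨a, h, le_rfl⟩⟩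
  rintro ⟨b, hb, hba⟩
  exact hb.mono le_rfl hba

theorem monomial_mem_monomialIdeal_pow {q : ℕ} {a : σ →₀ ℕ} :
    monomial a (1 : K) ∈ monomialIdeal K d ^ q ↔ Packs d q a := by
  classical
  simp [mem_monomialIdeal_pow, support_monomial]

/-- The ideal generated by the variables in `C`. -/
noncomputable def variableIdeal (K : Type*) [Field K] (C : Finset σ) :
    Ideal (MvPolynomial σ K) :=
  monomialIdeal K fun v : C => Finsupp.single (v : σ) 1

theorem packs_single_iff {C : Finset σ} {q : ℕ} {a : σ →₀ ℕ} :
    Packs (fun v : C => Finsupp.single (v : σ) 1) q a ↔ q ≤ ∑ v ∈ C, a v := by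
  classical
  refine ⟨fun h => h.le_sum_cover fun v => ⟨v, v.2, by simp⟩, fun h => ⟨fun v => a v, ?_, ?_⟩⟩
  · rwa [Finset.sum_coe_sort C fun v => a v]
  · rw [Finset.sum_coe_sort C fun v => a v • Finsupp.single v 1]
    intro w
    simp only [Finsupp.smul_single, smul_eq_mul, mul_one, Finsupp.coe_finsetSum,
      Finset.sum_apply, Finsupp.single_apply, Finset.sum_ite_eq']
    split_ifs <;> simp

theorem mem_variableIdeal_pow {C : Finset σ} {q : ℕ} {f : MvPolynomial σ K} :
    f ∈ variableIdeal K C ^ q ↔ ∀ a ∈ f.support, q ≤ ∑ v ∈ C, a v := by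
  simp only [variableIdeal, mem_monomialIdeal_pow, packs_single_iff]

/-- The order of a polynomial with respect to the variables in `C`. -/
noncomputable def variableOrder (C : Finset σ) (f : MvPolynomial σ K) : ℕ∞ :=
  open Classical in
  (f : MvPowerSeries σ K).weightedOrder fun v => if v ∈ C then 1 else 0

theorem mem_variableIdeal_pow_iff_le_variableOrder {C : Finset σ} {q : ℕ} {f : MvPolynomial σ K} :
    f ∈ variableIdeal K C ^ q ↔ q ≤ variableOrder C f := by
  classical
  have hw : ∀ a : σ →₀ ℕ, Finsupp.weight (fun v => if v ∈ C then 1 else 0) a =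
      ∑ v ∈ C, a v := by
    intro a
    rw [Finsupp.weight_apply, Finsupp.sum]
    simp only [smul_eq_mul, mul_ite, mul_one, mul_zero]
    rw [← Finset.sum_filter]
    refine Finset.sum_subset (fun v hv => (Finset.mem_filter.1 hv).2) fun v hv h => ?_
    by_contra h0
    exact h (Finset.mem_filter.2 ⟨Finsupp.mem_support_iff.2 h0, hv⟩)
  rw [mem_variableIdeal_pow, variableOrder]
  constructor
  · intro h
    refine MvPowerSeries.nat_le_weightedOrder _ fun a ha => ?_
    rw [MvPolynomial.coeff_coe]
    by_contra h0
    have := h a (mem_support_iff.2 h0)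
    rw [← hw] at this
    convert ha.not_ge this
  · intro h a ha
    by_contra! hlt
    refine mem_support_iff.1 ha ?_
    rw [← MvPolynomial.coeff_coe]
    refine MvPowerSeries.coeff_eq_zero_of_lt_weightedOrder (fun v => if v ∈ C then 1 else 0) ?_
    refine lt_of_lt_of_le ?_ h
    rw [hw]
    exact_mod_cast hlt

theorem mem_variableIdeal_iff {C : Finset σ} {f : MvPolynomial σ K} :
    f ∈ variableIdeal K C ↔ 1 ≤ variableOrder C f := by
  rw [← pow_one (variableIdeal K C), mem_variableIdeal_pow_iff_le_variableOrder, Nat.cast_one]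

/-- Inherited from weighted orders of power series over a field. -/
theorem variableOrder_mul (C : Finset σ) (f g : MvPolynomial σ K) :
    variableOrder C (f * g) = variableOrder C f + variableOrder C g := by
  rw [variableOrder, MvPolynomial.coe_mul, MvPowerSeries.weightedOrder_mul]
  rfl

/-- Powers of `P_C` are `P_C`-primary: an element outside `P_C` has order 0. -/
theorem mem_variableIdeal_pow_of_mul_mem {C : Finset σ} {q : ℕ} {f g : MvPolynomial σ K}
    (hfg : f * g ∈ variableIdeal K C ^ q) (hf : f ∉ variableIdeal K C) :
    g ∈ variableIdeal K C ^ q := by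
  rw [mem_variableIdeal_iff, Order.one_le_iff_ne_zero, not_not] at hf
  rw [mem_variableIdeal_pow_iff_le_variableOrder] at hfg ⊢
  rwa [variableOrder_mul, hf, zero_add] at hfg

instance variableIdeal_isPrime (C : Finset σ) : (variableIdeal K C).IsPrime := by
  refine ⟨?_, fun {f g} h => or_iff_not_imp_left.2 fun hf => ?_⟩
  · rw [Ideal.ne_top_iff_one, ← pow_one (variableIdeal K C), mem_variableIdeal_pow]
    intro h
    simpa using h 0 (by simp)
  · rw [← pow_one (variableIdeal K C)] at h ⊢
    exact mem_variableIdeal_pow_of_mul_mem h hf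

theorem mem_variableIdeal_pow_of_sq_mem {C : Finset σ} {q : ℕ} {f : MvPolynomial σ K}
    (h : f * f ∈ variableIdeal K C ^ (q + q + 1)) : f ∈ variableIdeal K C ^ (q + 1) := by
  rw [mem_variableIdeal_pow_iff_le_variableOrder] at h ⊢
  rw [variableOrder_mul] at h
  generalize variableOrder C f = m at *
  cases m with
  | top => exact le_top
  -- Parity: `2m ≥ 2q + 1` forces `m ≥ q + 1`.
  | coe m => norm_cast at *; omega

theorem variableIdeal_le_iff {C : Finset σ} {J : Ideal (MvPolynomial σ K)} :
    variableIdeal K C ≤ J ↔ ∀ v ∈ C, X v ∈ J := by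
  rw [variableIdeal, monomialIdeal, Ideal.span_le]
  constructor
  · intro h v hv
    exact h ⟨⟨v, hv⟩, rfl⟩
  · rintro h _ ⟨v, rfl⟩
    exact h v v.2

theorem X_mem_variableIdeal {C : Finset σ} {v : σ} :
    X v ∈ variableIdeal K C ↔ v ∈ C := by
  classical
  rw [← pow_one (variableIdeal K C), mem_variableIdeal_pow]
  simp [support_X, Finsupp.single_apply, Nat.one_le_iff_ne_zero]

theorem variableIdeal_le_variableIdeal {C D : Finset σ} :
    variableIdeal K C ≤ variableIdeal K D ↔ C ⊆ D := by
  rw [variableIdeal_le_iff]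
  simp only [X_mem_variableIdeal]
  rfl

theorem monomialIdeal_le_variableIdeal {C : Finset σ} (hC : IsCover d C) :
    monomialIdeal K d ≤ variableIdeal K C := by
  intro f hf
  rw [← pow_one (monomialIdeal K d), mem_monomialIdeal_pow] at hf
  rw [← pow_one (variableIdeal K C), mem_variableIdeal_pow]
  exact fun a ha => (hf a ha).le_sum_cover hC

-- A prime containing every edge monomial contains a variable of each, so its variables form a
-- cover.
omit [Fintype ε] in
theorem exists_isCover_variableIdeal_le [Fintype σ] {p : Ideal (MvPolynomial σ K)} [hp : p.IsPrime]
    (h : monomialIdeal K d ≤ p) : ∃ C, Minimal (IsCover d) C ∧ variableIdeal K C ≤ p := by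
  classical
  obtain ⟨C, hC, hmin⟩ := IsCover.exists_minimal_subset (d := d)
    (C := Finset.univ.filter fun v => X v ∈ p) (by
      intro e
      have he : monomial (d e) (1 : K) ∈ p := h (Ideal.subset_span ⟨e, rfl⟩)
      rw [monomial_eq, C_1, one_mul, Finsupp.prod, hp.prod_mem_iff] at he
      obtain ⟨v, hv, hvp⟩ := he
      exact ⟨v, by simpa using hp.mem_of_pow_mem _ hvp, Finsupp.mem_support_iff.1 hv⟩)
  exact ⟨C, hmin, variableIdeal_le_iff.2 fun v hv => (Finset.mem_filter.1 (hC hv)).2⟩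

section Squarefree

variable [Fintype σ] (hd : ∀ e v, d e v ≤ 1)
include hd

/-- For an exponent `a` of `f` outside the ideal, the zero set of `a` is a cover: a squarefree
generator avoiding it would divide the monomial. Hence the ideal is the intersection of the `P_C`.
-/
theorem exists_isCover_notMem {f : MvPolynomial σ K} (hf : f ∉ monomialIdeal K d) :
    ∃ C, Minimal (IsCover d) C ∧ f ∉ variableIdeal K C := by
  classical
  rw [← pow_one (monomialIdeal K d), mem_monomialIdeal_pow] at hf
  push Not at hf
  obtain ⟨a, ha, hna⟩ := hf
  obtain ⟨C, hC, hmin⟩ := IsCover.exists_minimal_subset (d := d)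
    (C := Finset.univ.filter fun v => a v = 0) (by
      intro e
      by_contra! h
      refine hna ((packs_one e).mono le_rfl fun v => ?_)
      by_cases hv : a v = 0
      · rw [h v (by simpa using hv)]; exact Nat.zero_le _
      · exact (hd e v).trans (Nat.one_le_iff_ne_zero.2 hv))
  refine ⟨C, hmin, fun h => ?_⟩
  rw [← pow_one (variableIdeal K C), mem_variableIdeal_pow] at h
  have := h a ha
  rw [Finset.sum_eq_zero fun v hv => (Finset.mem_filter.1 (hC hv)).2] at this
  omega

/-- For a minimal cover `C`, some element outside of the prime `(X v : v ∈ C)` multiplies it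
into the monomial ideal. -/
theorem exists_notMem_mul_mem {C : Finset σ} (hC : Minimal (IsCover d) C) :
    ∃ s ∉ variableIdeal K C, ∀ f ∈ variableIdeal K C, s * f ∈ monomialIdeal K d := by
  classical
  refine ⟨∏ w ∈ Cᶜ, X w, ?_, ?_⟩
  · rw [(variableIdeal_isPrime C).prod_mem_iff]
    rintro ⟨w, hw, h⟩
    exact (Finset.mem_compl.1 hw) (X_mem_variableIdeal.1 h)
  · suffices h : variableIdeal K C ≤ Submodule.comap
        (LinearMap.mulLeft (MvPolynomial σ K) (∏ w ∈ Cᶜ, X w)) (monomialIdeal K d) from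
      fun f hf => h hf
    refine variableIdeal_le_iff.2 fun v hv => ?_
    -- By minimality some edge meets `C` only in `v`; its monomial divides `X v` times the product
    -- of the variables outside `C`.
    obtain ⟨e, he⟩ : ∃ e, ∀ w ∈ C.erase v, d e w = 0 := by
      by_contra! h
      exact Finset.notMem_erase v C (hC.2 (y := C.erase v) h (Finset.erase_subset v C) hv)
    have h1 : (∏ w ∈ Cᶜ, X w) * X v =
        monomial (∑ w ∈ Cᶜ, Finsupp.single w 1 + Finsupp.single v 1) (1 : K) := by
      rw [← one_mul (1 : K), ← monomial_mul, monomial_sum_one]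
      simp [X]
    rw [Submodule.mem_comap, LinearMap.mulLeft_apply, h1, ← pow_one (monomialIdeal K d),
      monomial_mem_monomialIdeal_pow]
    refine (packs_one e).mono le_rfl fun w => ?_
    simp only [Finsupp.add_apply, Finsupp.coe_finsetSum, Finset.sum_apply, Finsupp.single_apply,
      Finset.sum_ite_eq', Finset.mem_compl]
    by_cases hw : w ∈ C
    · by_cases hvw : v = w
      · simpa [hvw] using (hd e w).trans (Nat.le_add_left _ _)
      · rw [he w (Finset.mem_erase.2 ⟨Ne.symm hvw, hw⟩)]; exact Nat.zero_le _
    · simpa [hw] using (hd e w).trans (Nat.le_add_right _ _)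

end Squarefree

end Packing

/-! ### Associated primes, symbolic powers and normal torsion-freeness -/

theorem mem_associatedPrimes_quotient_iff {R : Type*} [CommRing R] [IsNoetherianRing R]
    {J p : Ideal R} : p ∈ associatedPrimes R (R ⧸ J) ↔
      p.IsPrime ∧ ∃ g, ∀ r, r ∈ p ↔ r * g ∈ J := by
  rw [AssociatedPrimes.mem_iff, isAssociatedPrime_iff]
  refine and_congr_right fun _ => ?_
  rw [(Ideal.Quotient.mk_surjective (I := J)).exists]
  refine exists_congr fun g => ?_
  rw [SetLike.ext_iff]
  refine forall_congr' fun r => ?_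
  rw [Submodule.mem_colon_singleton, Submodule.mem_bot, ← Ideal.Quotient.eq_zero_iff_mem (I := J),
    map_mul]
  rfl

theorem exists_associatedPrime_of_notMem {R : Type*} [CommRing R] [IsNoetherianRing R]
    {J : Ideal R} {f : R} (hf : f ∉ J) :
    ∃ p ∈ associatedPrimes R (R ⧸ J), ∀ r, r * f ∈ J → r ∈ p := by
  obtain ⟨p, hp, hle⟩ := exists_le_isAssociatedPrime_of_isNoetherianRing R
    (Ideal.Quotient.mk J f) (fun h => hf (Ideal.Quotient.eq_zero_iff_mem.1 h))
  refine ⟨p, hp, fun r hr => hle ?_⟩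
  rw [Submodule.mem_colon_singleton, Submodule.mem_bot]
  rw [← Ideal.Quotient.eq_zero_iff_mem, map_mul] at hr
  exact hr

namespace Packing

open MvPolynomial

variable {σ ε K : Type*} [Fintype ε] [Field K] {d : ε → σ →₀ ℕ} [Fintype σ]

/-- If `p = (I : g)`, then `g` avoids some `P_C`, so `p ≤ P_C`; and `p` contains some `P_D` because
it contains `I`. Minimality of `C` forces equality. -/
theorem mem_associatedPrimes_iff (hd : ∀ e v, d e v ≤ 1) {p : Ideal (MvPolynomial σ K)} :
    p ∈ associatedPrimes _ (MvPolynomial σ K ⧸ monomialIdeal K d) ↔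
      ∃ C, Minimal (IsCover d) C ∧ p = variableIdeal K C := by
  rw [mem_associatedPrimes_quotient_iff]
  constructor
  · rintro ⟨hp, g, hg⟩
    have hg' : g ∉ monomialIdeal K d := fun h => hp.one_notMem ((hg 1).2 (by rwa [one_mul]))
    obtain ⟨C, hC, hgC⟩ := exists_isCover_notMem hd hg'
    obtain ⟨D, hD, hDp⟩ := exists_isCover_variableIdeal_le (d := d) (p := p)
      fun f hf => (hg f).2 (Ideal.mul_mem_right _ _ hf)
    have hpC : p ≤ variableIdeal K C := fun f hf =>
      ((variableIdeal_isPrime C).mem_or_mem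
        (monomialIdeal_le_variableIdeal hC.1 ((hg f).1 hf))).resolve_right hgC
    have hCD : C = D := le_antisymm
      (hC.2 hD.1 (variableIdeal_le_variableIdeal.1 (hDp.trans hpC)))
      (variableIdeal_le_variableIdeal.1 (hDp.trans hpC))
    exact ⟨C, hC, le_antisymm hpC (hCD ▸ hDp)⟩
  · rintro ⟨C, hC, rfl⟩
    obtain ⟨s, hs, hsC⟩ := exists_notMem_mul_mem (K := K) hd hC
    refine ⟨inferInstance, s, fun r => ⟨fun hr => mul_comm s r ▸ hsC r hr, fun hr => ?_⟩⟩
    exact ((variableIdeal_isPrime C).mem_or_mem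
      (monomialIdeal_le_variableIdeal hC.1 hr)).resolve_right hs

theorem mem_symbPow_iff (hd : ∀ e v, d e v ≤ 1) {q : ℕ} {f : MvPolynomial σ K} :
    f ∈ symbPow (monomialIdeal K d) q ↔
      ∀ C, Minimal (IsCover d) C → f ∈ variableIdeal K C ^ q := by
  simp only [symbPow, Submodule.mem_iInf, mem_associatedPrimes_iff hd]
  constructor
  · exact fun h C hC => h _ ⟨C, hC, rfl⟩
  · rintro h _ ⟨C, hC, rfl⟩
    exact h C hC

theorem pow_le_symbPow (hd : ∀ e v, d e v ≤ 1) (q : ℕ) :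
    monomialIdeal K d ^ q ≤ symbPow (monomialIdeal K d) q := fun _ hf =>
  (mem_symbPow_iff hd).2 fun _ hC =>
    Ideal.pow_right_mono (monomialIdeal_le_variableIdeal hC.1) q hf

/-- If packing numbers equal covering numbers, then symbolic and ordinary powers agree. -/
theorem symbPow_eq_pow (hd : ∀ e v, d e v ≤ 1) (hd0 : ∀ e, d e ≠ 0)
    (h : ∀ a, ∃ C, IsCover d C ∧ ∑ v ∈ C, a v ≤ packingNumber d a) (q : ℕ) :
    symbPow (monomialIdeal K d) q = monomialIdeal K d ^ q := by
  refine le_antisymm (fun f hf => ?_) (pow_le_symbPow hd q)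
  rw [mem_symbPow_iff hd] at hf
  refine mem_monomialIdeal_pow.2 fun a ha => ?_
  obtain ⟨C, hC, hCa⟩ := h a
  obtain ⟨D, hDC, hD⟩ := hC.exists_minimal_subset
  rw [← le_packingNumber_iff hd0]
  exact (mem_variableIdeal_pow.1 (hf D hD) a ha).trans
    ((Finset.sum_le_sum_of_subset hDC).trans hCa)

/-- For `p = (I^q : g)`, the element `g` is missing from some `P_C^q`; since this power is primary,
`p ≤ P_C`, and `p` is squeezed as for `q = 1`. Conversely each `P_C` is minimal over `I^q`. -/
theorem isNormallyTorsionFree_of_symbPow_eq_pow (hd : ∀ e v, d e v ≤ 1)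
    (h : ∀ q, symbPow (monomialIdeal K d) q = monomialIdeal K d ^ q) :
    IsNormallyTorsionFree (monomialIdeal K d) := by
  suffices hq : ∀ q, 1 ≤ q →
      associatedPrimes _ (MvPolynomial σ K ⧸ monomialIdeal K d ^ q) =
        associatedPrimes _ (MvPolynomial σ K ⧸ monomialIdeal K d) by
    intro p q hp hq'
    rw [hq p hp, hq q hq']
  intro q hq
  ext p
  constructor
  · intro hp
    obtain ⟨hp, g, hg⟩ := mem_associatedPrimes_quotient_iff.1 hp
    have hg' : g ∉ monomialIdeal K d ^ q := fun h => hp.one_notMem ((hg 1).2 (by rwa [one_mul]))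
    rw [← h q, mem_symbPow_iff hd] at hg'
    push Not at hg'
    obtain ⟨C, hC, hgC⟩ := hg'
    have hpC : p ≤ variableIdeal K C := by
      intro f hf
      by_contra hfC
      refine hgC (mem_variableIdeal_pow_of_mul_mem ?_ hfC)
      exact Ideal.pow_right_mono (monomialIdeal_le_variableIdeal hC.1) q ((hg f).1 hf)
    obtain ⟨D, hD, hDp⟩ := exists_isCover_variableIdeal_le (d := d) (p := p)
      fun f hf => hp.mem_of_pow_mem q
        ((hg _).2 (Ideal.mul_mem_right _ _ (Ideal.pow_mem_pow hf q)))
    have hCD : C = D := le_antisymm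
      (hC.2 hD.1 (variableIdeal_le_variableIdeal.1 (hDp.trans hpC)))
      (variableIdeal_le_variableIdeal.1 (hDp.trans hpC))
    exact (mem_associatedPrimes_iff hd).2 ⟨C, hC, le_antisymm hpC (hCD ▸ hDp)⟩
  · intro hp
    obtain ⟨C, hC, rfl⟩ := (mem_associatedPrimes_iff hd).1 hp
    refine Module.associatedPrimes.minimalPrimes_annihilator_subset_associatedPrimes _ _ ?_
    rw [Ideal.annihilator_quotient]
    refine ⟨⟨inferInstance, (Ideal.pow_le_self (by omega)).trans
      (monomialIdeal_le_variableIdeal hC.1)⟩, fun p ⟨hp, hpq⟩ hpC => ?_⟩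
    obtain ⟨D, hD, hDp⟩ := exists_isCover_variableIdeal_le (d := d) (p := p)
      fun f hf => hp.mem_of_pow_mem q (hpq (Ideal.pow_mem_pow hf q))
    exact (variableIdeal_le_variableIdeal.2
      (hC.2 hD.1 (variableIdeal_le_variableIdeal.1 (hDp.trans hpC)))).trans hDp

/-- If `f ∈ I^(q)` were not in `I^q`, some `P_C` would contain `(I^q : f)`. But `s P_C ≤ I` with `s
∉ P_C` gives `s^q f ∈ I^q`. -/
theorem symbPow_eq_pow_of_isNormallyTorsionFree (hd : ∀ e v, d e v ≤ 1)
    (h : IsNormallyTorsionFree (monomialIdeal K d)) (q : ℕ) :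
    symbPow (monomialIdeal K d) q = monomialIdeal K d ^ q := by
  refine le_antisymm (fun f hf => ?_) (pow_le_symbPow hd q)
  rcases Nat.eq_zero_or_pos q with rfl | hq
  · simp
  by_contra hfq
  obtain ⟨p, hp, hpf⟩ := exists_associatedPrime_of_notMem hfq
  rw [h q 1 hq le_rfl, pow_one] at hp
  obtain ⟨C, hC, rfl⟩ := (mem_associatedPrimes_iff hd).1 hp
  obtain ⟨s, hs, hsC⟩ := exists_notMem_mul_mem (K := K) hd hC
  refine hs ((variableIdeal_isPrime C).mem_of_pow_mem q (hpf _ ?_))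
  have h1 : Ideal.span {s} * variableIdeal K C ≤ monomialIdeal K d := by
    rw [Ideal.span_singleton_mul_le_iff]
    exact hsC
  refine Ideal.pow_right_mono h1 q ?_
  rw [mul_pow]
  exact Ideal.mul_mem_mul (Ideal.pow_mem_pow (Ideal.mem_span_singleton_self s) q)
    ((mem_symbPow_iff hd).1 hf C hC)

end Packing

/-! ### Reducedness of the associated graded ring -/

namespace AssocGraded

variable {R : Type*} [CommRing R] (I : Ideal R)

/-- The associated graded ring is reduced if squares of elements of order `q` have
order at most `2 * q`. -/
theorem isReduced_of_sq
    (h : ∀ q, ∀ f ∈ I ^ q, f * f ∈ I ^ (q + q + 1) → f ∈ I ^ (q + 1)) :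
    IsReduced (AssocGradedRing I) := by
  classical
  rw [isReduced_iff_pow_one_lt 2 one_lt_two]
  intro x hx
  by_contra hx0
  have hne : x.support.Nonempty := by
    rw [Finset.nonempty_iff_ne_empty]
    exact fun h0 => hx0 (DFinsupp.support_eq_empty.1 h0)
  -- Only the square of the top component contributes to degree `2m` of `x^2`.
  set m := x.support.max' hne
  have hm : m ∈ x.support := Finset.max'_mem _ _
  rw [sq, DirectSum.mul_eq_sum_support_ghas_mul] at hx
  have h1 := congrArg (fun y : AssocGradedRing I => y (m + m)) hx
  simp only [DirectSum.sum_apply, DirectSum.zero_apply] at h1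
  rw [Finset.sum_eq_single (m, m)] at h1
  · rw [DirectSum.of_eq_same] at h1
    obtain ⟨a, ha⟩ := mk_surjective I m (x m)
    refine DFinsupp.mem_support_iff.1 hm ?_
    change GradedMonoid.GMul.mul (x m) (x m) = 0 at h1
    rw [← ha] at h1
    change mk I (m + m) (powMul I m m a a) = 0 at h1
    rw [mk_eq_zero_iff] at h1
    have := h m a a.2 h1
    rw [← mk_eq_zero_iff, ha] at this
    exact this
  · rintro ⟨i, j⟩ hij hne'
    rw [Finset.mem_product] at hij
    have hi : i ≤ m := Finset.le_max' _ _ hij.1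
    have hj : j ≤ m := Finset.le_max' _ _ hij.2
    refine DirectSum.of_eq_of_ne _ _ _ fun h0 => hne' ?_
    simp only at h0
    ext <;> simp only <;> omega
  · intro h0
    exact (h0 (Finset.mk_mem_product hm hm)).elim

/-- The existential carries the proof that `a^k` lies in `I^(k * q)`; the degrees agree only
propositionally, hence the transports. -/
theorem of_mk_pow {q : ℕ} (a : ↥(I ^ q)) (k : ℕ) :
    ∃ b : ↥(I ^ (k * q)), (b : R) = a ^ k ∧
      (DirectSum.of (Piece I) q (mk I q a) : AssocGradedRing I) ^ k =
        DirectSum.of (Piece I) (k * q) (mk I (k * q) b) := by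
  induction k with
  | zero =>
    refine ⟨⟨1, by simp⟩, by simp, ?_⟩
    rw [pow_zero, DirectSum.one_def]
    exact DirectSum.of_eq_of_gradedMonoid_eq
      (gradedMk_eq I (zero_mul q).symm ⟨1, by simp⟩ ⟨1, by simp⟩ rfl)
  | succ k ih =>
    obtain ⟨b, hb, hbk⟩ := ih
    have hmem : (b : R) * a ∈ I ^ ((k + 1) * q) := by
      rw [add_mul, one_mul, pow_add]
      exact Ideal.mul_mem_mul b.2 a.2
    refine ⟨⟨b * a, hmem⟩, by simp only [hb, pow_succ], ?_⟩
    rw [pow_succ, hbk, of_mk_mul_of_mk]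
    exact DirectSum.of_eq_of_gradedMonoid_eq (gradedMk_eq I (by ring) _ _ rfl)

theorem mem_of_pow_mem_of_isReduced [IsReduced (AssocGradedRing I)] {q k : ℕ} {f : R}
    (hf : f ∈ I ^ q) (hk : f ^ k ∈ I ^ (k * q + 1)) : f ∈ I ^ (q + 1) := by
  obtain ⟨b, hb, hbk⟩ := of_mk_pow I ⟨f, hf⟩ k
  have h0 : mk I (k * q) b = 0 := by
    rw [mk_eq_zero_iff, hb]
    exact hk
  rw [h0, map_zero] at hbk
  have h1 := (IsNilpotent.eq_zero ⟨k, hbk⟩ :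
    (DirectSum.of (Piece I) q (mk I q ⟨f, hf⟩) : AssocGradedRing I) = 0)
  rwa [← map_zero (DirectSum.of (Piece I) q), (DirectSum.of_injective q).eq_iff,
    mk_eq_zero_iff] at h1

end AssocGraded

namespace Packing

open MvPolynomial

variable {σ ε K : Type*} [Fintype ε] [Field K] {d : ε → σ →₀ ℕ}

theorem isReduced_of_symbPow_eq_pow [Fintype σ] (hd : ∀ e v, d e v ≤ 1)
    (h : ∀ q, symbPow (monomialIdeal K d) q = monomialIdeal K d ^ q) :
    IsReduced (AssocGradedRing (monomialIdeal K d)) := by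
  refine AssocGraded.isReduced_of_sq _ fun q f _ hff => ?_
  rw [← h, mem_symbPow_iff hd] at hff ⊢
  exact fun C hC => mem_variableIdeal_pow_of_sq_mem (hff C hC)

theorem packingNumber_smul_le_of_isReduced (hd0 : ∀ e, d e ≠ 0)
    [IsReduced (AssocGradedRing (monomialIdeal K d))] (k : ℕ) (a : σ →₀ ℕ) :
    packingNumber d (k • a) ≤ k * packingNumber d a := by
  by_contra! h
  have h1 : Packs d (k * packingNumber d a + 1) (k • a) := (le_packingNumber_iff hd0).1 h
  rw [← monomial_mem_monomialIdeal_pow (K := K),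
    show monomial (k • a) (1 : K) = monomial a 1 ^ k by rw [monomial_pow, one_pow]] at h1
  have h2 := AssocGraded.mem_of_pow_mem_of_isReduced (monomialIdeal K d)
    (monomial_mem_monomialIdeal_pow.2 (packs_packingNumber hd0 a)) h1
  rw [monomial_mem_monomialIdeal_pow, ← le_packingNumber_iff hd0] at h2
  omega

end Packing

/-! ### The linear programs of a hypergraph -/

namespace Hypergraph

open Packing

variable {α : Type*} (G : Hypergraph α)

open Classical in
/-- The exponent vector of the monomial of an edge. -/
noncomputable def edgeExponent [Fintype G.vertexSet] (e : G.edgeSet) : G.vertexSet →₀ ℕ :=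
  Finsupp.equivFunOnFinite.symm fun v => if (v : α) ∈ (e : Set α) then 1 else 0

section

variable [Fintype G.vertexSet]

open Classical in
theorem edgeExponent_apply (e : G.edgeSet) (v : G.vertexSet) :
    G.edgeExponent e v = if (v : α) ∈ (e : Set α) then 1 else 0 := rfl

theorem edgeExponent_le_one (e : G.edgeSet) (v : G.vertexSet) : G.edgeExponent e v ≤ 1 := by
  rw [edgeExponent_apply]
  split_ifs <;> simp

theorem edgeExponent_ne_zero (hne : ∀ e ∈ G.edgeSet, e.Nonempty) (e : G.edgeSet) :
    G.edgeExponent e ≠ 0 := by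
  obtain ⟨x, hx⟩ := hne e e.2
  intro h
  have := DFunLike.congr_fun h ⟨x, G.mem_vertexSet_of_mem_edgeSet e.2 hx⟩
  simp [edgeExponent_apply, hx] at this

theorem edgeIdeal_eq_monomialIdeal (K : Type*) [Field K] :
    G.edgeIdeal K = monomialIdeal K G.edgeExponent := by
  classical
  rw [edgeIdeal, monomialIdeal, Set.image_eq_range]
  congr 2
  funext e
  rw [edgeMonomial, MvPolynomial.monomial_eq, Finsupp.prod_fintype _ _ (by simp), map_one, one_mul]
  refine Finset.prod_congr rfl fun v _ => ?_
  rw [edgeExponent_apply]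
  split_ifs <;> simp

theorem incMatrix_apply (v : G.vertexSet) (e : G.edgeSet) :
    G.incMatrix v e = (G.edgeExponent e v : ℝ) := by
  classical
  rw [incMatrix, edgeExponent_apply]
  split_ifs <;> simp

variable [Fintype G.edgeSet]

theorem mem_packings_iff {c : G.vertexSet → ℝ} {y : G.edgeSet → ℝ} :
    y ∈ G.packings c ↔ (∀ e, 0 ≤ y e) ∧ ∀ v, ∑ e, G.edgeExponent e v * y e ≤ c v := by
  simp only [packings, Set.mem_ofPred_eq, Pi.le_def, Matrix.mulVec, dotProduct, incMatrix_apply,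
    Pi.zero_apply]

omit [Fintype G.edgeSet] in
theorem mem_coverings_iff {z : G.vertexSet → ℝ} :
    z ∈ G.coverings ↔ (∀ v, 0 ≤ z v) ∧ ∀ e, 1 ≤ ∑ v, G.edgeExponent e v * z v := by
  simp only [coverings, Set.mem_ofPred_eq, Pi.le_def, Matrix.mulVec, dotProduct,
    Matrix.transpose_apply, incMatrix_apply, Pi.zero_apply, Pi.one_apply]

theorem natCast_mem_packings_iff {a : G.vertexSet →₀ ℕ} {y : G.edgeSet → ℕ} :
    (fun e => (y e : ℝ)) ∈ G.packings (fun v => (a v : ℝ)) ↔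
      ∑ e, y e • G.edgeExponent e ≤ a := by
  rw [mem_packings_iff, Finsupp.le_def]
  simp only [Nat.cast_nonneg, implies_true, true_and, Finsupp.coe_finsetSum, Finset.sum_apply,
    Finsupp.coe_smul, Pi.smul_apply, smul_eq_mul]
  refine forall_congr' fun v => ?_
  rw [← Nat.cast_le (α := ℝ)]
  push_cast
  simp only [mul_comm]

/-- Weak linear programming duality. -/
theorem sum_le_of_mem_packings_of_mem_coverings {c : G.vertexSet → ℝ} {y : G.edgeSet → ℝ}
    {z : G.vertexSet → ℝ} (hy : y ∈ G.packings c) (hz : z ∈ G.coverings) :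
    ∑ e, y e ≤ ∑ v, c v * z v := by
  rw [mem_packings_iff] at hy
  rw [mem_coverings_iff] at hz
  calc ∑ e, y e ≤ ∑ e, y e * ∑ v, G.edgeExponent e v * z v :=
        Finset.sum_le_sum fun e _ => le_mul_of_one_le_right (hy.1 e) (hz.2 e)
    _ = ∑ v, (∑ e, G.edgeExponent e v * y e) * z v := by
        simp only [Finset.mul_sum, Finset.sum_mul]
        rw [Finset.sum_comm]
        exact Finset.sum_congr rfl fun v _ => Finset.sum_congr rfl fun e _ => by ring
    _ ≤ ∑ v, c v * z v :=
        Finset.sum_le_sum fun v _ => mul_le_mul_of_nonneg_right (hy.2 v) (hz.1 v)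

/-- Only the integrality of the maximum is needed: an optimal integral packing of `a` beats the
fractional packing `y / k`. -/
theorem HasMFMC.packingNumber_smul_le {G : Hypergraph α} [Fintype G.vertexSet]
    [Fintype G.edgeSet] (h : G.HasMFMC) (hne : ∀ e ∈ G.edgeSet, e.Nonempty)
    (k : ℕ) (a : G.vertexSet →₀ ℕ) :
    packingNumber G.edgeExponent (k • a) ≤ k * packingNumber G.edgeExponent a := by
  have hd0 := G.edgeExponent_ne_zero hne
  obtain ⟨y, hy, hya⟩ := packs_packingNumber hd0 (k • a)
  rcases Nat.eq_zero_or_pos k with rfl | hk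
  · have h0 := Packs.le_degree hd0 (packs_packingNumber hd0 (0 • a))
    rw [zero_smul, map_zero] at h0
    rw [zero_smul]
    omega
  have hk' : (0 : ℝ) < k := by exact_mod_cast hk
  obtain ⟨⟨x, hx, hmax⟩, -⟩ := h a
  lift x to G.edgeSet → ℕ using fun e => by exact_mod_cast (mem_packings_iff G).1 hx |>.1 e
  simp only [Int.cast_natCast] at hx hmax
  have h1 : ∑ e, x e ≤ packingNumber G.edgeExponent a :=
    (le_packingNumber_iff hd0).2 ⟨x, le_rfl, (natCast_mem_packings_iff G).1 hx⟩
  have h2 : (fun e => (y e : ℝ) / k) ∈ G.packings (fun v => (a v : ℝ)) := by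
    rw [← natCast_mem_packings_iff, mem_packings_iff] at hya
    rw [mem_packings_iff]
    refine ⟨fun e => by positivity, fun v => ?_⟩
    have := hya.2 v
    simp only [← mul_div_assoc, ← Finset.sum_div]
    rw [div_le_iff₀ hk']
    simpa [mul_comm] using this
  have h3 : ∑ e, (y e : ℝ) / k ≤ ∑ e, (x e : ℝ) := by
    simpa [one_dotProduct] using hmax h2
  rw [← Finset.sum_div, div_le_iff₀ hk'] at h3
  norm_cast at h3
  calc _ ≤ ∑ e, y e := hy
    _ ≤ (∑ e, x e) * k := h3
    _ ≤ _ := by rw [mul_comm]; exact Nat.mul_le_mul_left k h1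

/-- The indicator of `C` and a maximum integral packing are feasible, and the first has value at
most that of the second; weak duality makes both optimal among real solutions. -/
theorem hasMFMC_of_exists_isCover (hne : ∀ e ∈ G.edgeSet, e.Nonempty)
    (h : ∀ a, ∃ C, IsCover G.edgeExponent C ∧
      ∑ v ∈ C, a v ≤ packingNumber G.edgeExponent a) : G.HasMFMC := by
  classical
  intro c
  obtain ⟨a, rfl⟩ : ∃ a : G.vertexSet →₀ ℕ, ⇑a = c := ⟨Finsupp.equivFunOnFinite.symm c, rfl⟩
  obtain ⟨y, hy, hya⟩ := packs_packingNumber (G.edgeExponent_ne_zero hne) a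
  obtain ⟨C, hC, hCa⟩ := h a
  rw [← natCast_mem_packings_iff] at hya
  have hz : (fun v => if v ∈ C then (1 : ℝ) else 0) ∈ G.coverings := by
    rw [mem_coverings_iff]
    refine ⟨fun v => by positivity, fun e => ?_⟩
    obtain ⟨v, hv, hev⟩ := hC e
    refine le_trans ?_ (Finset.single_le_sum (f := fun v =>
      (G.edgeExponent e v : ℝ) * if v ∈ C then (1 : ℝ) else 0)
      (fun _ _ => by positivity) (Finset.mem_univ v))
    simpa [hv] using Nat.one_le_iff_ne_zero.2 hev
  have hle : ∑ v, (a v : ℝ) * (if v ∈ C then (1 : ℝ) else 0) ≤ ∑ e, (y e : ℝ) := by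
    simp only [mul_ite, mul_one, mul_zero, Finset.sum_ite_mem, Finset.univ_inter]
    exact_mod_cast hCa.trans hy
  refine ⟨⟨fun e => y e, by simpa using hya, fun y' hy' => ?_⟩,
    ⟨fun v => if v ∈ C then 1 else 0, by simpa using hz, fun z' hz' => ?_⟩⟩
  · simpa [one_dotProduct] using (G.sum_le_of_mem_packings_of_mem_coverings hy' hz).trans hle
  · simpa [dotProduct] using hle.trans (G.sum_le_of_mem_packings_of_mem_coverings hya hz')

end

end Hypergraph

theorem mainTheorem2 {α : Type*} (G : Hypergraph α) [Fintype G.vertexSet] [Fintype G.edgeSet]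
    (hG : G.IsSimple) (hne : ∀ e ∈ G.edgeSet, e.Nonempty) (K : Type*) [Field K] :
    List.TFAE
      [G.HasMFMC,
       ∀ q : ℕ, symbPow (G.edgeIdeal K) q = G.edgeIdeal K ^ q,
       IsReduced (AssocGradedRing (G.edgeIdeal K)),
       IsNormallyTorsionFree (G.edgeIdeal K)] := by
  rw [G.edgeIdeal_eq_monomialIdeal K]
  have hd := G.edgeExponent_le_one
  have hd0 := G.edgeExponent_ne_zero hne
  tfae_have 1 → 2 := fun h =>
    Packing.symbPow_eq_pow hd hd0 (Packing.exists_isCover_sum_le hd0 (h.packingNumber_smul_le hne))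
  tfae_have 2 → 3 := Packing.isReduced_of_symbPow_eq_pow hd
  tfae_have 3 → 1 := fun _ => G.hasMFMC_of_exists_isCover hne
    (Packing.exists_isCover_sum_le hd0 (Packing.packingNumber_smul_le_of_isReduced (K := K) hd0))
  tfae_have 2 → 4 := Packing.isNormallyTorsionFree_of_symbPow_eq_pow hd
  tfae_have 4 → 2 := Packing.symbPow_eq_pow_of_isNormallyTorsionFree hd
  tfae_finish
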